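/- Let $p$ be a prime, let $\mathbb{C}_p$ be the completion of an algebraic closure of $\mathbb{Q}_p$, $\mathcal{O}_p=\{z\in\mathbb{C}_p : |z|\le 1\}$, and let $k$ be the residue field of $\mathcal{O}_p$. Let $G$ be a subgroup (discrete or not) of $\mathrm{PSL}(2,\mathbb{C}_p)$, acting on $\mathbb{P}^1(\mathbb{C}_p)=\mathbb{C}_p\cup\{\infty\}$ by Möbius maps, where $\mathbb{P}^1(\mathbb{C}_p)$ carries the chordal distance $\rho_v(z,w)=\frac{|z-w|}{\max\{1,|z|\}\max\{1,|w|\}}$, $\rho_v(\infty,w)=\rho_v(w,\infty)=\frac{1}{\max\{1,|w|\}}$ for $z,w\in\mathbb{C}_p$, and $\rho_v(\infty,\infty)=0$. The limit set of $G$ is the set of all $a\in\mathbb{P}^1(\mathbb{C}_p)$ for which there exist $b\in\mathbb{P}^1(\mathbb{C}_p)$ and a sequence $(g_n)_{n\ge 1}$ of pairwise distinct elements of $G$ with $\lim_{n\to\infty} g_n(b)=a$. A map $f\in\mathrm{PSL}(2,\mathbb{C}_p)$ has good reduction if it can be written in homogeneous coordinates as $f([x:y])=[\alpha x+\beta y:\gamma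 x+\delta y]$ with $\alpha,\beta,\gamma,\delta\in\mathcal{O}_p$, at least one of them of absolute value $1$, such that the reductions of the two linear forms have no common zero in $k\times k$ other than $(0,0)$. The group $G$ has potentially good reduction if there is one $h\in\mathrm{PSL}(2,\mathbb{C}_p)$ such that $h^{-1}\circ g\circ h$ has good reduction for every $g\in G$. If the limit set of $G$ is empty, then $G$ has potentially good reduction. -/

import Mathlib

open Filter Topology

namespace PadicMobius

/-- The group `PSL(2, ℂ_p) = SL(2, ℂ_p) / {± I}` (the center of `SL(2, ℂ_p)` is `{± I}`). -/
abbrev PSL2 (p : ℕ) [Fact p.Prime] : Type :=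
  Matrix.ProjectiveSpecialLinearGroup (Fin 2) ℂ_[p]

/-- The projective line `ℙ¹(ℂ_p)`: lines in `ℂ_p²`. The point `z ∈ ℂ_p` is `[z : 1]` and `∞` is
`[1 : 0]`, so that Mathlib's action of `PSL(2, ℂ_p)` is `z ↦ (az + b) / (cz + d)`. -/
abbrev P1 (p : ℕ) [Fact p.Prime] : Type :=
  Projectivization ℂ_[p] (Fin 2 → ℂ_[p])

/-- The chordal distance on `ℙ¹(ℂ_p)` in homogeneous coordinates,
`|x₀ y₁ - x₁ y₀| / (max {|x₀|, |x₁|} max {|y₀|, |y₁|})`; the norm of `Fin 2 → ℂ_[p]` is the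
maximum norm. The lemmas below give its independence of the coordinates and its values on
`ℂ_p ∪ {∞}`. -/
noncomputable def chordalDist {p : ℕ} [Fact p.Prime] (x y : P1 p) : ℝ :=
  ‖x.rep 0 * y.rep 1 - x.rep 1 * y.rep 0‖ / (‖x.rep‖ * ‖y.rep‖)

theorem chordalDist_mk {p : ℕ} [Fact p.Prime] (v w : Fin 2 → ℂ_[p]) (hv : v ≠ 0) (hw : w ≠ 0) :
    chordalDist (Projectivization.mk ℂ_[p] v hv) (Projectivization.mk ℂ_[p] w hw) =
      ‖v 0 * w 1 - v 1 * w 0‖ / (‖v‖ * ‖w‖) := by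
  obtain ⟨a, ha⟩ := Projectivization.exists_smul_eq_mk_rep ℂ_[p] v hv
  obtain ⟨b, hb⟩ := Projectivization.exists_smul_eq_mk_rep ℂ_[p] w hw
  have ha0 : ‖(a : ℂ_[p])‖ ≠ 0 := norm_ne_zero_iff.2 a.ne_zero
  have hb0 : ‖(b : ℂ_[p])‖ ≠ 0 := norm_ne_zero_iff.2 b.ne_zero
  have e : (a • v) 0 * (b • w) 1 - (a • v) 1 * (b • w) 0 =
      ((a : ℂ_[p]) * b) * (v 0 * w 1 - v 1 * w 0) := by
    simp only [Pi.smul_apply, Units.smul_def, smul_eq_mul]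
    ring
  rw [chordalDist, ← ha, ← hb, e, norm_mul, norm_mul, Units.smul_def, Units.smul_def,
    norm_smul, norm_smul]
  have : ‖(a : ℂ_[p])‖ * ‖v‖ * (‖(b : ℂ_[p])‖ * ‖w‖) =
      (‖(a : ℂ_[p])‖ * ‖(b : ℂ_[p])‖) * (‖v‖ * ‖w‖) := by ring
  rw [this, mul_div_mul_left _ _ (mul_ne_zero ha0 hb0)]

/-- The point of `ℙ¹(ℂ_p)` given by `z ∈ ℂ_p`. -/
noncomputable def ofAffine {p : ℕ} [Fact p.Prime] (z : ℂ_[p]) : P1 p :=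
  Projectivization.mk ℂ_[p] ![z, 1] (fun h => one_ne_zero (congrFun h 1))

/-- The point `∞` of `ℙ¹(ℂ_p)`. -/
noncomputable def infinity (p : ℕ) [Fact p.Prime] : P1 p :=
  Projectivization.mk ℂ_[p] ![1, 0] (fun h => one_ne_zero (congrFun h 0))

theorem norm_pair {p : ℕ} [Fact p.Prime] (a b : ℂ_[p]) : ‖![a, b]‖ = max ‖a‖ ‖b‖ := by
  apply le_antisymm
  · refine (pi_norm_le_iff_of_nonneg (le_max_of_le_left (norm_nonneg a))).2 fun i => ?_
    fin_cases i <;> simp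
  · exact max_le (norm_le_pi_norm ![a, b] 0) (norm_le_pi_norm ![a, b] 1)

theorem chordalDist_ofAffine {p : ℕ} [Fact p.Prime] (z w : ℂ_[p]) :
    chordalDist (ofAffine z) (ofAffine w) = ‖z - w‖ / (max 1 ‖z‖ * max 1 ‖w‖) := by
  rw [ofAffine, ofAffine, chordalDist_mk, norm_pair, norm_pair]
  simp [max_comm]

theorem chordalDist_infinity_ofAffine {p : ℕ} [Fact p.Prime] (w : ℂ_[p]) :
    chordalDist (infinity p) (ofAffine w) = 1 / max 1 ‖w‖ := by
  rw [infinity, ofAffine, chordalDist_mk, norm_pair, norm_pair]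
  simp [max_comm]

theorem chordalDist_self {p : ℕ} [Fact p.Prime] (x : P1 p) : chordalDist x x = 0 := by
  simp [chordalDist, mul_comm]

/-- The limit set of `G`: the points `a` for which there are a point `b` and a sequence of pairwise
distinct elements `g₀, g₁, …` of `G` such that `gₙ(b)` tends to `a` in the chordal distance. -/
def limitSet {p : ℕ} [Fact p.Prime] (G : Subgroup (PSL2 p)) : Set (P1 p) :=
  {a | ∃ (b : P1 p) (g : ℕ → PSL2 p), (∀ n, g n ∈ G) ∧ Function.Injective g ∧
    Tendsto (fun n => chordalDist (g n • b) a) atTop (𝓝 0)}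

/-- The rows of `A` are the coefficients of two linear forms over `𝒪_p`, and these give the map `f`
in homogeneous coordinates: `f([x : y]) = [A₀₀ x + A₀₁ y : A₁₀ x + A₁₁ y]` for every point. -/
def IsPresentation {p : ℕ} [Fact p.Prime] (A : Matrix (Fin 2) (Fin 2) 𝓞_ℂ_[p]) (f : PSL2 p) :
    Prop :=
  ∀ (v : Fin 2 → ℂ_[p]) (hv : v ≠ 0),
    ∃ hA : (A.map (fun a => (a : ℂ_[p]))).mulVec v ≠ 0,
      f • Projectivization.mk ℂ_[p] v hv =
        Projectivization.mk ℂ_[p] ((A.map (fun a => (a : ℂ_[p]))).mulVec v) hA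

/-- Good reduction of a Möbius map (a rational map of degree one): it has a presentation by two
linear forms over `𝒪_p`, at least one coefficient having absolute value `1`, whose reductions have
no common zero in `k × k` but `(0, 0)`, where `k` is the residue field. -/
def HasGoodReduction {p : ℕ} [Fact p.Prime] (f : PSL2 p) : Prop :=
  ∃ A : Matrix (Fin 2) (Fin 2) 𝓞_ℂ_[p],
    IsPresentation A f ∧ (∃ i j, ‖(A i j : ℂ_[p])‖ = 1) ∧
    ∀ v : Fin 2 → IsLocalRing.ResidueField 𝓞_ℂ_[p],
      (A.map (IsLocalRing.residue 𝓞_ℂ_[p])).mulVec v = 0 → v = 0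

/-- A subgroup has potentially good reduction if a single conjugation makes all of its elements
have good reduction. -/
def HasPotentiallyGoodReduction {p : ℕ} [Fact p.Prime] (G : Subgroup (PSL2 p)) : Prop :=
  ∃ h : PSL2 p, ∀ g ∈ G, HasGoodReduction (h⁻¹ * g * h)

end PadicMobius

/-!
If the limit set is empty then every point stabilizer in `G` is finite: a point fixed by infinitely
many elements is a limit point. Since every Möbius map has a fixed point, `G` is a torsion group,
hence locally finite by Schur's theorem on linear torsion groups, and every nontrivial element has
exactly two fixed points. As for finite rotation groups, the Riemann–Hurwitz formula then shows that
every finite subgroup `F` of order larger than `60` has an orbit `F x` with at most two points. Let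
`F` run over the finite subgroups that contain a given `F₁` of order larger than `60`. As `F₁ x` has
at most two points, `x` is one of the finitely many points with nontrivial stabilizer in `F₁`; their
stabilizers in `G` are finite, so `|F|` is bounded and `G` is finite. A finite group preserves a
lattice in `ℂ_p²`, and a basis of this lattice conjugates it to maps with integral coefficients and
determinant `1`.
-/

namespace PadicMobius

open Matrix MulAction

section GroupActions

/-- The points of `X` with nontrivial stabilizer, i.e. the ramification points of
`X → X / F`. -/
def nonfreePoints (F X : Type*) [Group F] [MulAction F X] : SubMulAction F X where
  carrier := {x | ∃ g : F, g ≠ 1 ∧ g • x = x}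
  smul_mem' := by
    rintro c x ⟨g, hg, hx⟩
    exact ⟨c * g * c⁻¹, by simpa using hg, by simp [mul_smul, hx]⟩

variable {F X : Type*} [Group F] [MulAction F X]

theorem finite_nonfreePoints [Finite F] (hfix : ∀ g : F, g ≠ 1 → (fixedBy X g).Finite) :
    Finite (nonfreePoints F X) := by
  have hcover : (nonfreePoints F X : Set X) ⊆ ⋃ g : {g : F // g ≠ 1}, fixedBy X g.1 := by
    rintro x ⟨g, hg, hx⟩
    exact Set.mem_iUnion.2 ⟨⟨g, hg⟩, hx⟩
  exact (Set.finite_iUnion fun g : {g : F // g ≠ 1} => hfix g.1 g.2).subset hcover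

theorem ncard_fixedBy_nonfreePoints {g : F} (hg : g ≠ 1) :
    (fixedBy (nonfreePoints F X) g).ncard = (fixedBy X g).ncard := by
  rw [← Set.ncard_image_of_injective _ Subtype.val_injective]
  congr 1
  ext x
  constructor
  · rintro ⟨y, hy, rfl⟩
    exact congrArg Subtype.val hy
  · exact fun hx => ⟨⟨x, g, hg, hx⟩, Subtype.ext hx, rfl⟩

theorem stabilizer_ne_bot_of_mem_nonfreePoints {x : X} (hx : x ∈ nonfreePoints F X) :
    stabilizer F x ≠ ⊥ := by
  obtain ⟨g, hg, hgx⟩ := hx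
  exact fun h => hg ((Subgroup.eq_bot_iff_forall _).1 h g hgx)

theorem stabilizer_eq_bot_of_notMem_nonfreePoints {x : X} (hx : x ∉ nonfreePoints F X) :
    stabilizer F x = ⊥ :=
  (Subgroup.eq_bot_iff_forall _).2 fun g hgx => by_contra fun hg => hx ⟨g, hg, hgx⟩

theorem sum_index_stabilizer_out [Finite X] [Fintype (orbitRel.Quotient F X)] :
    ∑ ω : orbitRel.Quotient F X, (stabilizer F ω.out).index = Nat.card X := by
  simp only [index_stabilizer, ← Nat.card_coe_set_eq]
  rw [Nat.card_congr (selfEquivSigmaOrbits F X), Nat.card_sigma]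

/-- Burnside's lemma in the form of the Riemann–Hurwitz formula: with `n ω` the order of the
stabilizer it reads `∑ ω, (1 - 1 / n ω) = c * (1 - 1 / |F|)`. -/
theorem sum_index_stabilizer_add_mul_card [Finite F] [Finite X]
    [Fintype (orbitRel.Quotient F X)] {c : ℕ} (hfix : ∀ g : F, g ≠ 1 → (fixedBy X g).ncard = c) :
    ∑ ω : orbitRel.Quotient F X, (stabilizer F ω.out).index + c * Nat.card F =
      Fintype.card (orbitRel.Quotient F X) * Nat.card F + c := by
  classical
  have := Fintype.ofFinite F
  have := Fintype.ofFinite X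
  have hfixed : ∑ g : F, (fixedBy X g).ncard + c = Nat.card X + c * Nat.card F := by
    rw [← Finset.add_sum_erase _ _ (Finset.mem_univ (1 : F)),
      Finset.sum_congr rfl fun g hg => hfix g (Finset.ne_of_mem_erase hg), Finset.sum_const,
      smul_eq_mul, fixedBy_one_eq_univ, Set.ncard_univ, add_assoc, ← Nat.succ_mul,
      Nat.succ_eq_add_one, Finset.card_erase_add_one (Finset.mem_univ _), Finset.card_univ,
      Nat.card_eq_fintype_card (α := F), mul_comm c]
  have hburnside := sum_card_fixedBy_eq_card_orbits_mul_card_group F X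
  simp only [← Nat.card_eq_fintype_card, Nat.card_coe_set_eq] at hburnside ⊢
  rw [sum_index_stabilizer_out, ← hfixed, hburnside]

end GroupActions

/-- The non-dihedral signatures `(N / a, N / b, N / c)` of finite rotation groups; the extremal one
is the icosahedral `(2, 3, 5)`. -/
theorem le_sixty_of_dvd_of_add_add_eq {N a b c : ℕ} (ha : a ∣ N) (hb : b ∣ N) (hc : c ∣ N)
    (haN : 2 * a ≤ N) (hbN : 2 * b ≤ N) (hcN : 2 * c ≤ N) (ha3 : 3 ≤ a) (hb3 : 3 ≤ b) (hc3 : 3 ≤ c)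
    (h : a + b + c = N + 2) : N ≤ 60 := by
  wlog hca : c ≤ a generalizing a c
  · exact this hc ha hcN haN hc3 ha3 (by omega) (by omega)
  wlog hcb : c ≤ b generalizing b c
  · exact this hc hcN hc3 hb hbN hb3 (by omega) (by omega) (by omega)
  wlog hba : b ≤ a generalizing a b
  · exact this hb hbN hb3 ha haN ha3 (by omega) hcb hca (by omega)
  obtain ⟨k, hk⟩ := ha
  obtain ⟨l, hl⟩ := hb
  obtain ⟨m, hm⟩ := hc
  have hk_eq : k = 2 := by
    have : 2 ≤ k := by by_contra! hlt; interval_cases k <;> omega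
    have : k < 3 := by by_contra! hge; nlinarith
    omega
  have hl_eq : l = 3 := by
    have : l < 4 := by by_contra! hge; nlinarith
    subst hk_eq
    interval_cases l <;> omega
  have hm_lt : m < 6 := by by_contra! hge; nlinarith
  subst hk_eq hl_eq
  interval_cases m <;> omega

theorem exists_index_stabilizer_le_two {F X : Type*} [Group F] [MulAction F X]
    (hfix : ∀ g : F, g ≠ 1 → (fixedBy X g).ncard = 2) (hF : 60 < Nat.card F) :
    ∃ x : X, (stabilizer F x).index ≤ 2 := by
  classical
  by_contra! hcon
  have : Finite F := Nat.finite_of_card_ne_zero (by omega)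
  have := finite_nonfreePoints fun (g : F) hg =>
    Set.finite_of_ncard_pos (by rw [hfix g hg]; exact two_pos)
  let Ω := orbitRel.Quotient F (nonfreePoints F X)
  have := Fintype.ofFinite Ω
  let s : Ω → ℕ := fun ω => (stabilizer F ω.out).index
  have hs_dvd : ∀ ω, s ω ∣ Nat.card F := fun ω => Subgroup.index_dvd_card _
  have hs_ge : ∀ ω, 3 ≤ s ω := fun ω => by
    simpa only [s, SubMulAction.stabilizer_of_subMul] using Nat.succ_le_of_lt (hcon ω.out.1)
  have hs_le : ∀ ω, 2 * s ω ≤ Nat.card F := fun ω => by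
    have hbot := stabilizer_ne_bot_of_mem_nonfreePoints ω.out.2
    rw [← SubMulAction.stabilizer_of_subMul] at hbot
    rw [← Subgroup.card_mul_index (stabilizer F ω.out)]
    exact Nat.mul_le_mul_right _ ((Subgroup.one_lt_card_iff_ne_bot _).2 hbot)
  have hRH : ∑ ω, s ω + 2 * Nat.card F = Fintype.card Ω * Nat.card F + 2 :=
    sum_index_stabilizer_add_mul_card fun g hg => by
      rw [ncard_fixedBy_nonfreePoints hg, hfix g hg]
  have hsum_le : 2 * ∑ ω, s ω ≤ Fintype.card Ω * Nat.card F := by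
    rw [Finset.mul_sum, ← smul_eq_mul, ← Finset.card_univ]
    exact Finset.sum_le_card_nsmul _ _ _ fun ω _ => hs_le ω
  have hsum_ge : Fintype.card Ω * 3 ≤ ∑ ω, s ω := by
    rw [← smul_eq_mul, ← Finset.card_univ]
    exact Finset.card_nsmul_le_sum _ _ _ fun ω _ => hs_ge ω
  have horbits : Fintype.card Ω = 3 := by
    have : Fintype.card Ω < 4 := by by_contra! hge; nlinarith
    interval_cases _ : Fintype.card Ω <;> omega
  obtain ⟨x, y, z, hxy, hxz, hyz, hΩ⟩ := Finset.card_eq_three.1 horbits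
  rw [hΩ, Finset.sum_insert (by simp [hxy, hxz]), Finset.sum_pair hyz, horbits] at hRH
  exact hF.not_ge <| le_sixty_of_dvd_of_add_add_eq (hs_dvd x) (hs_dvd y) (hs_dvd z)
    (hs_le x) (hs_le y) (hs_le z) (hs_ge x) (hs_ge y) (hs_ge z) (by omega)

/-- Every finitely generated subgroup of `G` is finite. -/
def IsLocallyFiniteGroup (G : Type*) [Group G] : Prop :=
  ∀ H : Subgroup G, H.FG → Finite H

namespace IsLocallyFiniteGroup

variable {G : Type*} [Group G]

theorem of_surjective {H : Type*} [Group H] (hG : IsLocallyFiniteGroup G) (f : G →* H)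
    (hf : Function.Surjective f) : IsLocallyFiniteGroup H := by
  classical
  rintro _ ⟨S, rfl⟩
  let T := S.image (Function.surjInv hf)
  have hT : f '' T = S := by
    rw [Finset.coe_image, ← Set.image_comp, (Function.rightInverse_surjInv hf).comp_eq_id,
      Set.image_id]
  have := hG _ ⟨T, rfl⟩
  rw [← hT, ← MonoidHom.map_closure]
  exact Set.Finite.image f this

theorem exists_finite_ge_lt_card [Infinite G] (hG : IsLocallyFiniteGroup G) (F : Subgroup G)
    [Finite F] (m : ℕ) : ∃ F' : Subgroup G, F ≤ F' ∧ Finite F' ∧ m < Nat.card F' := by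
  obtain ⟨T, hT⟩ := Infinite.exists_subset_card_eq G (m + 1)
  have hfin := hG (F ⊔ Subgroup.closure T)
    (((Group.fg_iff_subgroup_fg F).1 inferInstance).sup ⟨T, rfl⟩)
  refine ⟨_, le_sup_left, hfin, ?_⟩
  have hsub : (T : Set G) ⊆ (F ⊔ Subgroup.closure T : Subgroup G) :=
    Subgroup.subset_closure.trans (SetLike.coe_subset_coe.2 le_sup_right)
  calc m < (T : Set G).ncard := by rw [Set.ncard_coe_finset, hT]; exact m.lt_succ_self
    _ ≤ Nat.card (F ⊔ Subgroup.closure T : Subgroup G) := Set.ncard_le_ncard hsub hfin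

theorem finite_of_ncard_fixedBy_eq_two {X : Type*} [MulAction G X] (hG : IsLocallyFiniteGroup G)
    (hfix : ∀ g : G, g ≠ 1 → (fixedBy X g).ncard = 2) (hstab : ∀ x : X, Finite (stabilizer G x)) :
    Finite G := by
  by_contra hinf
  rw [not_finite_iff_infinite] at hinf
  have hfixF (F : Subgroup G) (g : F) (hg : g ≠ 1) : (fixedBy X g).ncard = 2 :=
    hfix g fun h => hg (Subtype.ext h)
  obtain ⟨F₁, -, hF₁, hcard₁⟩ := hG.exists_finite_ge_lt_card ⊥ 60
  have hfinite := finite_nonfreePoints fun (g : F₁) hg =>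
    Set.finite_of_ncard_pos (by rw [hfixF F₁ g hg]; exact two_pos)
  obtain ⟨M, hM⟩ := (Set.finite_range fun x : nonfreePoints F₁ X =>
    Nat.card (stabilizer G x.1)).bddAbove
  obtain ⟨F, hle, hF, hcard⟩ := hG.exists_finite_ge_lt_card F₁ (60 + 2 * M)
  obtain ⟨x, hx⟩ := exists_index_stabilizer_le_two (hfixF F) (by omega)
  have hxF₁ : x ∈ nonfreePoints F₁ X := by
    by_contra hx₁
    have hindex : (stabilizer F₁ x).index ≤ (stabilizer F x).index :=
      Subgroup.relIndex_le_of_le_right (H := stabilizer G x) hle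
        (Subgroup.FiniteIndex.index_ne_zero (H := stabilizer F x))
    rw [stabilizer_eq_bot_of_notMem_nonfreePoints hx₁, Subgroup.index_bot] at hindex
    omega
  have hxF : Nat.card (stabilizer F x) ≤ Nat.card (stabilizer G x) := by
    rw [← Subgroup.card_map_of_injective (K := stabilizer F x) (f := F.subtype)
      F.subtype_injective]
    exact Subgroup.card_le_of_le (Subgroup.map_le_iff_le_comap.2 fun g hg => hg)
  have hxM : Nat.card (stabilizer G x) ≤ M := hM ⟨⟨x, hxF₁⟩, rfl⟩
  have := Subgroup.card_mul_index (stabilizer F x)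
  nlinarith

end IsLocallyFiniteGroup

theorem isMulTorsion_of_exists_smul_eq {G X : Type*} [Group G] [MulAction G X]
    (hfix : ∀ g : G, ∃ x : X, g • x = x) (hstab : ∀ x : X, Finite (stabilizer G x)) :
    IsMulTorsion G := by
  intro g
  obtain ⟨x, hx⟩ := hfix g
  have := hstab x
  exact (stabilizer G x).subtype.isOfFinOrder (isOfFinOrder_of_finite (⟨g, hx⟩ : stabilizer G x))

section FiniteTypeOverInt

instance isJacobsonRing_int : IsJacobsonRing ℤ := by
  rw [isJacobsonRing_iff_prime_eq]
  intro P hP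
  by_cases hbot : P = ⊥
  · subst hbot
    refine eq_bot_iff.2 fun x hx => ?_
    have hunit : IsUnit (x * x + 1) := Ideal.mem_jacobson_bot.1 hx x
    rw [Ideal.mem_bot]
    rcases Int.isUnit_iff.1 hunit with h | h <;> nlinarith
  · have := hP.isMaximal hbot
    exact Ideal.jacobson_eq_self_of_isMaximal

theorem finite_quotient_of_finiteType_int {A : Type*} [CommRing A] [Algebra.FiniteType ℤ A]
    (m : Ideal A) [m.IsMaximal] : Finite (A ⧸ m) := by
  let := Ideal.Quotient.field m
  have : Module.Finite ℤ (A ⧸ m) := finite_of_finite_type_of_isJacobsonRing ℤ (A ⧸ m)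
  obtain ⟨q, hq⟩ := CharP.exists (A ⧸ m)
  have hq0 : q ≠ 0 := by
    rintro rfl
    have : CharZero (A ⧸ m) := CharP.charP_to_charZero _
    exact Int.not_isField (isField_of_isIntegral_of_isField
      (R := ℤ) (S := A ⧸ m) (RingHom.injective_int _) (Field.toIsField _))
  have : NeZero q := ⟨hq0⟩
  let := ZMod.algebra (A ⧸ m) q
  have : Module.Finite (ZMod q) (A ⧸ m) := .of_restrictScalars_finite ℤ (ZMod q) (A ⧸ m)
  exact Module.finite_of_finite (ZMod q)

theorem exists_isMaximal_notMem {A : Type*} [CommRing A] [IsDomain A] [IsJacobsonRing A] {a : A}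
    (ha : a ≠ 0) : ∃ m : Ideal A, m.IsMaximal ∧ a ∉ m := by
  by_contra! hmem
  have hjac : a ∈ (⊥ : Ideal A).jacobson := Ideal.mem_sInf.2 fun {m} hm => hmem m hm.2
  rw [← Ideal.radical_eq_jacobson, Ideal.isRadical_bot.radical] at hjac
  exact ha hjac

end FiniteTypeOverInt

section Schur

theorem eq_one_of_pow_eq_one_of_map_eq_one {n R k : Type*} [Fintype n] [DecidableEq n] [CommRing R]
    [IsDomain R] [Field k] (φ : R →+* k) {q : ℕ} (hq : (q : k) ≠ 0) {M : Matrix n n R}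
    (hM : φ.mapMatrix M = 1) (hpow : M ^ q = 1) : M = 1 := by
  let U : Matrix n n R := ∑ i ∈ Finset.range q, M ^ i
  have hU : U * (M - 1) = 0 := by
    rw [geom_sum_mul, hpow, sub_self]
  have hUφ : φ.mapMatrix U = (q : k) • (1 : Matrix n n k) := by
    simp [U, map_sum, map_pow, hM, Nat.cast_smul_eq_nsmul]
  have hdet : U.det ≠ 0 := fun h => by
    have := φ.map_det U
    rw [h, hUφ, Matrix.det_smul, map_zero, Matrix.det_one, mul_one] at this
    exact pow_ne_zero _ hq this.symm
  have hsmul : U.det • (M - 1) = 0 := by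
    rw [← one_mul (M - 1), ← Matrix.smul_mul, ← Matrix.adjugate_mul, Matrix.mul_assoc, hU,
      Matrix.mul_zero]
  exact sub_eq_zero.1 ((smul_eq_zero.1 hsmul).resolve_left hdet)

theorem exists_orderOf_pow_prime {G : Type*} [Monoid G] {g : G} (hg : IsOfFinOrder g)
    (hg1 : g ≠ 1) : ∃ q : ℕ, q.Prime ∧ ∃ m : ℕ, orderOf (g ^ m) = q := by
  obtain ⟨q, hq, hdvd⟩ := Nat.exists_prime_and_dvd (mt orderOf_eq_one_iff.1 hg1)
  exact ⟨q, hq, _, orderOf_pow_orderOf_div hg.orderOf_pos.ne' hdvd⟩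

variable {n : Type*} [Fintype n] [DecidableEq n]

theorem natCast_eq_zero_of_orderOf_eq_of_map_eq_one {R k : Type*} [CommRing R] [IsDomain R]
    [Field k] (φ : R →+* k) {g : GL n R} {q : ℕ} (hq : q.Prime) (hg : orderOf g = q)
    (hφ : GeneralLinearGroup.map φ g = 1) : (q : k) = 0 := by
  by_contra hq0
  refine hq.ne_one ?_
  rw [← hg, orderOf_eq_one_iff]
  exact Units.ext <| eq_one_of_pow_eq_one_of_map_eq_one φ hq0 (congrArg Units.val hφ)
    (congrArg Units.val (hg ▸ pow_orderOf_eq_one g))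

-- The kernel of reduction modulo a maximal ideal has torsion of the residue characteristic only,
-- so reducing modulo two maximal ideals of different characteristics is injective on torsion.
theorem finite_of_forall_isOfFinOrder {A : Type*} [CommRing A] [IsDomain A] [CharZero A]
    [Algebra.FiniteType ℤ A] {Γ : Subgroup (GL n A)} (hΓ : ∀ g ∈ Γ, IsOfFinOrder g) :
    Finite Γ := by
  have : IsJacobsonRing A := isJacobsonRing_of_finiteType (A := ℤ)
  obtain ⟨m, hm⟩ := Ideal.exists_maximal A
  let := Ideal.Quotient.field m
  have hfin : Finite (A ⧸ m) := finite_quotient_of_finiteType_int m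
  obtain ⟨l, hl⟩ := CharP.exists (A ⧸ m)
  have hl0 : l ≠ 0 := CharP.char_ne_zero_of_finite (A ⧸ m) l
  obtain ⟨m', hm', hlm'⟩ := exists_isMaximal_notMem (Nat.cast_ne_zero (R := A).2 hl0)
  let := Ideal.Quotient.field m'
  have hfin' : Finite (A ⧸ m') := finite_quotient_of_finiteType_int m'
  let π := Ideal.Quotient.mk m
  let π' := Ideal.Quotient.mk m'
  let f : GL n A →* GL n (A ⧸ m) × GL n (A ⧸ m') :=
    (GeneralLinearGroup.map π).prod (GeneralLinearGroup.map π')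
  have hinj : Function.Injective (f.comp Γ.subtype) := by
    refine (injective_iff_map_eq_one _).2 fun g hfg => Subtype.ext ?_
    by_contra hg1
    obtain ⟨q, hq, i, hi⟩ := exists_orderOf_pow_prime (hΓ g g.2) hg1
    have hfi : f (g.1 ^ i) = 1 := (map_pow f g.1 i).trans (by rw [show f g.1 = 1 from hfg, one_pow])
    have hqm : (q : A ⧸ m) = 0 :=
      natCast_eq_zero_of_orderOf_eq_of_map_eq_one π hq hi (congrArg Prod.fst hfi)
    have hqm' : (q : A ⧸ m') = 0 :=
      natCast_eq_zero_of_orderOf_eq_of_map_eq_one π' hq hi (congrArg Prod.snd hfi)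
    have hlq : l = q := ((Nat.dvd_prime hq).1 ((CharP.cast_eq_zero_iff _ l q).1 hqm)).resolve_left
      (CharP.char_ne_one (A ⧸ m) l)
    exact hlm' (Ideal.Quotient.eq_zero_iff_mem.1 (by rw [map_natCast, hlq, hqm']))
  exact Finite.of_injective _ hinj

theorem mem_range_map_algebraMap {K : Type*} [Field K] {A : Subalgebra ℤ K} {g : GL n K}
    (hg : ∀ i j, g i j ∈ A) (hg' : ∀ i j, g⁻¹ i j ∈ A) :
    g ∈ (GeneralLinearGroup.map (n := n) (algebraMap A K)).range := by
  let M : Matrix n n A := .of fun i j => ⟨g i j, hg i j⟩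
  let M' : Matrix n n A := .of fun i j => ⟨g⁻¹ i j, hg' i j⟩
  have hinj : Function.Injective ((algebraMap A K).mapMatrix (m := n)) :=
    Matrix.map_injective Subtype.val_injective
  refine ⟨⟨M, M', hinj ?_, hinj ?_⟩, Units.ext rfl⟩
  · rw [map_mul, map_one]
    exact g.mul_inv
  · rw [map_mul, map_one]
    exact g.inv_mul

/-- Schur's theorem on linear torsion groups. -/
theorem IsLocallyFiniteGroup.of_isMulTorsion_of_injective {G K : Type*} [Group G] [Field K]
    [CharZero K] (hG : IsMulTorsion G) (f : G →* GL n K) (hf : Function.Injective f) :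
    IsLocallyFiniteGroup G := by
  rintro _ ⟨S, rfl⟩
  let entries (g : GL n K) : Set K := Set.range fun ij : n × n => g ij.1 ij.2
  let E : Set K := ⋃ g ∈ S, (entries (f g) ∪ entries (f g)⁻¹)
  have hE : E.Finite :=
    S.finite_toSet.biUnion fun g _ => (Set.finite_range _).union (Set.finite_range _)
  let A := Algebra.adjoin ℤ E
  have : Algebra.FiniteType ℤ A := .adjoin_of_finite hE
  let ι := GeneralLinearGroup.map (n := n) (algebraMap A K)
  let Γ := (Subgroup.closure S).map f
  have hΓι : Γ ≤ ι.range := by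
    refine Subgroup.map_le_iff_le_comap.2 ((Subgroup.closure_le _).2 fun g hg => ?_)
    exact mem_range_map_algebraMap
      (fun i j => Algebra.subset_adjoin (Set.mem_biUnion hg (.inl ⟨(i, j), rfl⟩)))
      (fun i j => Algebra.subset_adjoin (Set.mem_biUnion hg (.inr ⟨(i, j), rfl⟩)))
  have hι : Function.Injective ι :=
    Units.map_injective (Matrix.map_injective Subtype.val_injective)
  have hfin : Finite (Γ.comap ι) := finite_of_forall_isOfFinOrder fun x hx => by
    obtain ⟨g, -, hg⟩ := hx
    rw [← hι.isOfFinOrder_iff, ← hg]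
    exact f.isOfFinOrder (hG g)
  have hΓ : (Γ : Set (GL n K)).Finite := by
    rw [← Subgroup.map_comap_eq_self hΓι]
    exact Set.Finite.image ι hfin
  exact Set.Finite.of_finite_image hΓ hf.injOn

instance finite_center_specialLinearGroup {R : Type*} [CommRing R] [IsDomain R] :
    Finite (Subgroup.center (SpecialLinearGroup n R)) :=
  have : NeZero (max (Fintype.card n) 1) := ⟨by simp⟩
  Finite.of_equiv _ SpecialLinearGroup.center_equiv_rootsOfUnity.symm.toEquiv

section Quotient

variable {G : Type*} [Group G] {N : Subgroup G} [N.Normal] [Finite N]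

theorem isOfFinOrder_of_isOfFinOrder_mk {g : G} (h : IsOfFinOrder (g : G ⧸ N)) :
    IsOfFinOrder g := by
  obtain ⟨m, hm, hg⟩ := isOfFinOrder_iff_pow_eq_one.1 h
  rw [← QuotientGroup.mk_pow, QuotientGroup.eq_one_iff] at hg
  have hpow : IsOfFinOrder (g ^ m) :=
    N.subtype.isOfFinOrder (isOfFinOrder_of_finite (⟨g ^ m, hg⟩ : N))
  exact hpow.of_pow hm.ne'

instance finite_comap_mk' (Γ : Subgroup (G ⧸ N)) [Finite Γ] :
    Finite (Γ.comap (QuotientGroup.mk' N)) :=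
  Finite.of_equiv _ (QuotientGroup.preimageMkEquivSubgroupProdSet N Γ).symm

end Quotient

theorem isLocallyFiniteGroup_of_le_projectiveSpecialLinearGroup {K : Type*} [Field K] [CharZero K]
    {G : Subgroup (ProjectiveSpecialLinearGroup n K)} (hG : IsMulTorsion G) :
    IsLocallyFiniteGroup G := by
  let π := QuotientGroup.mk' (Subgroup.center (SpecialLinearGroup n K))
  have htorsion : IsMulTorsion (G.comap π) := fun A =>
    (G.comap π).subtype_injective.isOfFinOrder_iff.1 <| isOfFinOrder_of_isOfFinOrder_mk <|
      G.subtype.isOfFinOrder (hG ⟨π A, A.2⟩)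
  have hlocal : IsLocallyFiniteGroup (G.comap π) :=
    .of_isMulTorsion_of_injective htorsion (SpecialLinearGroup.toGL.comp (G.comap π).subtype)
      (SpecialLinearGroup.toGL_injective.comp (G.comap π).subtype_injective)
  exact hlocal.of_surjective (π.subgroupComap G)
    (π.subgroupComap_surjective_of_surjective G (QuotientGroup.mk'_surjective _))

end Schur

section FixedPoints

open Module.End (HasEigenvalue HasEigenvector)

variable {n K : Type*} [Fintype n] [DecidableEq n] [Field K]

theorem coe_smul_mk_eq_iff (A : SpecialLinearGroup n K) {v w : n → K} (hv : v ≠ 0) (hw : w ≠ 0) :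
    (A : ProjectiveSpecialLinearGroup n K) • Projectivization.mk K v hv =
      Projectivization.mk K w hw ↔ ∃ a : K, a • w = A.1 *ᵥ v := by
  rw [ProjectiveSpecialLinearGroup.smul_proj_mk, Projectivization.smul_mk,
    Projectivization.mk_eq_mk_iff']
  rfl

theorem coe_smul_mk_eq_self_iff (A : SpecialLinearGroup n K) {v : n → K} (hv : v ≠ 0) :
    (A : ProjectiveSpecialLinearGroup n K) • Projectivization.mk K v hv =
      Projectivization.mk K v hv ↔ ∃ a : K, HasEigenvector (toLin' A.1) a v := by
  simp only [coe_smul_mk_eq_iff, Module.End.hasEigenvector_iff, Module.End.mem_eigenspace_iff,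
    toLin'_apply, and_iff_left hv, eq_comm (b := A.1 *ᵥ v)]

theorem exists_smul_eq_self [Nonempty n] [IsAlgClosed K] (g : ProjectiveSpecialLinearGroup n K) :
    ∃ x : Projectivization K (n → K), g • x = x := by
  obtain ⟨A, rfl⟩ := QuotientGroup.mk_surjective g
  obtain ⟨a, ha⟩ := Module.End.exists_eigenvalue (toLin' A.1)
  obtain ⟨v, hv⟩ := ha.exists_hasEigenvector
  exact ⟨.mk K v hv.2, (coe_smul_mk_eq_self_iff A hv.2).2 ⟨a, hv⟩⟩

theorem coe_eq_one_iff (A : SpecialLinearGroup n K) :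
    (A : ProjectiveSpecialLinearGroup n K) = 1 ↔ A.1 ∈ Set.range (scalar n) := by
  rw [QuotientGroup.eq_one_iff, Matrix.SpecialLinearGroup.mem_center_iff]
  refine ⟨fun ⟨r, _, hr⟩ => ⟨r, hr⟩, fun ⟨r, hr⟩ => ⟨r, ?_, hr⟩⟩
  rw [← A.2, ← hr, scalar_apply, det_diagonal, Finset.prod_const, Finset.card_univ]

theorem discr_ne_zero_of_isOfFinOrder_coe [CharZero K] {A : SpecialLinearGroup (Fin 2) K}
    (hfin : IsOfFinOrder (A : ProjectiveSpecialLinearGroup (Fin 2) K))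
    (hA : (A : ProjectiveSpecialLinearGroup (Fin 2) K) ≠ 1) : A.1.discr ≠ 0 := by
  intro hdiscr
  obtain ⟨m, hm, hAm⟩ := isOfFinOrder_iff_pow_eq_one.1 hfin
  have hparabolic : (SpecialLinearGroup.toGL A).IsParabolic := ⟨mt (coe_eq_one_iff A).2 hA, hdiscr⟩
  rw [← QuotientGroup.mk_pow, coe_eq_one_iff, Matrix.SpecialLinearGroup.coe_pow] at hAm
  exact (hparabolic.pow hm.ne').1 hAm

theorem exists_hasEigenvector_pair_of_discr_ne_zero [IsAlgClosed K]
    {M : Matrix (Fin 2) (Fin 2) K} (hM : M.discr ≠ 0) :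
    ∃ μ ν : K, μ ≠ ν ∧ (∃ v, HasEigenvector (toLin' M) μ v) ∧
      ∃ w, HasEigenvector (toLin' M) ν w := by
  have hroot (a : K) : HasEigenvalue (toLin' M) a ↔ a ^ 2 - M.trace * a + M.det = 0 := by
    rw [Module.End.hasEigenvalue_iff_isRoot_charpoly, charpoly_toLin', charpoly_fin_two]
    simp
  obtain ⟨μ, hμ⟩ := Module.End.exists_eigenvalue (toLin' M)
  have hν : HasEigenvalue (toLin' M) (M.trace - μ) :=
    (hroot _).2 (by linear_combination (hroot μ).1 hμ)
  refine ⟨μ, _, fun h => hM ?_, hμ.exists_hasEigenvector, hν.exists_hasEigenvector⟩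
  rw [discr_fin_two]
  linear_combination -4 * (hroot μ).1 hμ + (2 * μ - M.trace) * h

theorem linearIndependent_pair_of_hasEigenvector {V : Type*} [AddCommGroup V] [Module K V]
    {f : Module.End K V} {μ ν : K} {v w : V} (hμν : μ ≠ ν) (hv : HasEigenvector f μ v)
    (hw : HasEigenvector f ν w) : LinearIndependent K ![v, w] := by
  refine Module.End.eigenvectors_linearIndependent' f ![μ, ν] ?_ _ ?_
  · simpa using hμν
  · simpa [Fin.forall_fin_two] using ⟨hv, hw⟩

theorem exists_smul_eq_of_hasEigenvector {V : Type*} [AddCommGroup V] [Module K V]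
    (hV : Module.finrank K V = 2) {f : Module.End K V} {μ ν a : K} {v w x : V} (hμν : μ ≠ ν)
    (hv : HasEigenvector f μ v) (hw : HasEigenvector f ν w) (hx : HasEigenvector f a x) :
    (∃ c : K, c • v = x) ∨ ∃ c : K, c • w = x := by
  have hli := linearIndependent_pair_of_hasEigenvector hμν hv hw
  have hspan := hli.span_eq_top_of_card_eq_finrank (by simp [hV])
  rw [range_cons, range_cons, range_empty, Set.union_empty, Set.singleton_union] at hspan
  obtain ⟨b, c, rfl⟩ := Submodule.mem_span_pair.1 (hspan ▸ Submodule.mem_top (x := x))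
  have hcoeff : (b * (μ - a)) • v + (c * (ν - a)) • w = 0 := by
    have := hx.apply_eq_smul
    rw [map_add, map_smul, map_smul, hv.apply_eq_smul, hw.apply_eq_smul, ← sub_eq_zero] at this
    rw [← this]
    module
  obtain ⟨hb, hc⟩ := LinearIndependent.pair_iff.1 hli _ _ hcoeff
  rcases mul_eq_zero.1 hb with rfl | hμ
  · exact .inr ⟨c, by rw [zero_smul, zero_add]⟩
  rcases mul_eq_zero.1 hc with rfl | hν
  · exact .inl ⟨b, by rw [zero_smul, add_zero]⟩
  exact absurd ((sub_eq_zero.1 hμ).trans (sub_eq_zero.1 hν).symm) hμν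

theorem ncard_fixedBy_eq_two [IsAlgClosed K] [CharZero K]
    {g : ProjectiveSpecialLinearGroup (Fin 2) K} (hfin : IsOfFinOrder g) (hg : g ≠ 1) :
    (fixedBy (Projectivization K (Fin 2 → K)) g).ncard = 2 := by
  obtain ⟨A, rfl⟩ := QuotientGroup.mk_surjective g
  obtain ⟨μ, ν, hμν, ⟨v, hv⟩, w, hw⟩ :=
    exists_hasEigenvector_pair_of_discr_ne_zero (discr_ne_zero_of_isOfFinOrder_coe hfin hg)
  refine Set.ncard_eq_two.2 ⟨.mk K v hv.2, .mk K w hw.2, ?_, Set.ext fun x => ?_⟩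
  · rw [Ne, Projectivization.mk_eq_mk_iff']
    rintro ⟨c, rfl⟩
    have := LinearIndependent.pair_iff.1 (linearIndependent_pair_of_hasEigenvector hμν hv hw)
    exact one_ne_zero (this 1 (-c) (by module)).1
  · induction x using Projectivization.ind with | _ x hx
    rw [mem_fixedBy, Set.mem_insert_iff, Set.mem_singleton_iff]
    constructor
    · intro hfix
      obtain ⟨a, ha⟩ := (coe_smul_mk_eq_self_iff A hx).1 hfix
      simpa only [Projectivization.mk_eq_mk_iff'] using
        exists_smul_eq_of_hasEigenvector (Module.finrank_fin_fun K) hμν hv hw ha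
    · rintro (h | h) <;> rw [h]
      · exact (coe_smul_mk_eq_self_iff A hv.2).2 ⟨μ, hv⟩
      · exact (coe_smul_mk_eq_self_iff A hw.2).2 ⟨ν, hw⟩

end FixedPoints

theorem finite_of_finite_stabilizer {K : Type*} [Field K] [IsAlgClosed K] [CharZero K]
    {G : Subgroup (ProjectiveSpecialLinearGroup (Fin 2) K)}
    (hstab : ∀ x : Projectivization K (Fin 2 → K), Finite (stabilizer G x)) : Finite G := by
  have htorsion : IsMulTorsion G := isMulTorsion_of_exists_smul_eq
    (fun g => exists_smul_eq_self (g : ProjectiveSpecialLinearGroup (Fin 2) K)) hstab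
  have hlocal : IsLocallyFiniteGroup G :=
    isLocallyFiniteGroup_of_le_projectiveSpecialLinearGroup htorsion
  refine hlocal.finite_of_ncard_fixedBy_eq_two (fun g hg => ?_) hstab
  exact ncard_fixedBy_eq_two (G.subtype.isOfFinOrder (htorsion g)) fun h => hg (Subtype.ext h)

section InvariantLattice

variable {n K : Type*} [Fintype n] [DecidableEq n] [NormedField K]

-- Choose the columns of `P` so that `|det P|` is maximal and bound coordinates by Cramer's rule.
theorem exists_norm_inv_mulVec_le_one {ι : Type*} [Finite ι] (s : ι → n → K) {f₀ : n → ι}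
    (hf₀ : (Matrix.of fun i j => s (f₀ j) i).det ≠ 0) :
    ∃ P : GL n K, (∀ j, ∃ k, P.1.col j = s k) ∧ ∀ k i, ‖(P⁻¹.1 *ᵥ s k) i‖ ≤ 1 := by
  let M (f : n → ι) : Matrix n n K := .of fun i j => s (f j) i
  have : Nonempty (n → ι) := ⟨f₀⟩
  obtain ⟨f, hf⟩ := Finite.exists_max fun f => ‖(M f).det‖
  have hdet : (M f).det ≠ 0 := norm_pos_iff.1 ((norm_pos_iff.2 hf₀).trans_le (hf f₀))
  refine ⟨.mkOfDetNeZero (M f) hdet, fun j => ⟨f j, rfl⟩, fun k i => ?_⟩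
  have hupdate : (M f).updateCol i (s k) = M (Function.update f i k) := by
    ext a b
    obtain rfl | hb := eq_or_ne b i
    · simp [M]
    · simp [M, hb]
  have hcramer : (M f).det * ((M f)⁻¹ *ᵥ s k) i = (M (Function.update f i k)).det := by
    rw [← hupdate, ← cramer_apply, ← det_smul_inv_mulVec_eq_cramer _ _ hdet.isUnit]
    rfl
  rw [GeneralLinearGroup.coe_inv]
  refine le_of_mul_le_mul_left ?_ (norm_pos_iff.2 hdet)
  calc ‖(M f).det‖ * ‖((M f)⁻¹ *ᵥ s k) i‖ = ‖(M (Function.update f i k)).det‖ := by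
        rw [← norm_mul, hcramer]
    _ ≤ ‖(M f).det‖ * 1 := (hf _).trans_eq (mul_one _).symm

theorem exists_conj_norm_le_one (Γ : Subgroup (GL n K)) [Finite Γ] :
    ∃ P : GL n K, ∀ g ∈ Γ, ∀ i j, ‖(P⁻¹ * g * P) i j‖ ≤ 1 := by
  let s (x : Γ × n) : n → K := x.1.1.1.col x.2
  have hdet : (Matrix.of fun i j => s (1, j) i).det ≠ 0 := (1 : GL n K).det_ne_zero
  obtain ⟨P, hcol, hP⟩ := exists_norm_inv_mulVec_le_one s hdet
  refine ⟨P, fun g hg i j => ?_⟩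
  obtain ⟨⟨g', l⟩, hl⟩ := hcol j
  have hentry : (P⁻¹ * g * P) i j = (P⁻¹.1 *ᵥ s (⟨g, hg⟩ * g', l)) i :=
    calc (P⁻¹ * g * P) i j = (P⁻¹.1 *ᵥ (g.1 *ᵥ P.1.col j)) i := by rw [mul_assoc]; rfl
      _ = (P⁻¹.1 *ᵥ (g.1 *ᵥ s (g', l))) i := by rw [hl]
      _ = (P⁻¹.1 *ᵥ s (⟨g, hg⟩ * g', l)) i := rfl
  rw [hentry]
  exact hP _ i

theorem exists_specialLinearGroup_conj_eq [IsAlgClosed K] [Nonempty n] (P : GL n K) :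
    ∃ h : SpecialLinearGroup n K, ∀ A : GL n K, (h : GL n K)⁻¹ * A * h = P⁻¹ * A * P := by
  obtain ⟨c, hc⟩ := IsAlgClosed.exists_pow_nat_eq P.1.det⁻¹ (n := Fintype.card n) Fintype.card_pos
  have hc0 : c ≠ 0 := by
    rintro rfl
    exact inv_ne_zero P.det_ne_zero (by rw [← hc, zero_pow Fintype.card_ne_zero])
  let h : SpecialLinearGroup n K :=
    ⟨c • P.1, by rw [det_smul, hc, inv_mul_cancel₀ P.det_ne_zero]⟩
  have hh : (h : GL n K) = Units.mk0 c hc0 • P := Units.ext rfl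
  refine ⟨h, fun A => ?_⟩
  rw [hh, Units.smul_inv]
  exact Units.ext (by simp [Units.smul_def, smul_smul, hc0])

theorem exists_specialLinearGroup_conj_norm_le_one [IsAlgClosed K] [Nonempty n]
    (Γ : Subgroup (SpecialLinearGroup n K)) [Finite Γ] :
    ∃ h : SpecialLinearGroup n K, ∀ g ∈ Γ, ∀ i j, ‖(h⁻¹ * g * h).1 i j‖ ≤ 1 := by
  have : Finite (Γ.map SpecialLinearGroup.toGL) :=
    Set.Finite.image SpecialLinearGroup.toGL (Set.toFinite (Γ : Set (SpecialLinearGroup n K)))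
  obtain ⟨P, hP⟩ := exists_conj_norm_le_one (Γ.map SpecialLinearGroup.toGL)
  obtain ⟨h, hh⟩ := exists_specialLinearGroup_conj_eq P
  refine ⟨h, fun g hg i j => ?_⟩
  have := hP g (Subgroup.mem_map_of_mem _ hg) i j
  rwa [← hh] at this

end InvariantLattice

section GoodReduction

variable {p : ℕ} [Fact p.Prime]

theorem mem_padicComplexInt_iff {x : ℂ_[p]} : x ∈ 𝓞_ℂ_[p] ↔ ‖x‖ ≤ 1 := by
  rw [PadicComplex.norm_eq_norm]
  exact (Valued.toNormedField.norm_le_one_iff (L := ℂ_[p]) (x := x)).symm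

theorem norm_eq_one_of_isUnit {x : 𝓞_ℂ_[p]} (hx : IsUnit x) : ‖(x : ℂ_[p])‖ = 1 := by
  obtain ⟨y, hxy⟩ := hx.exists_right_inv
  have hnorm : ‖(x : ℂ_[p])‖ * ‖(y : ℂ_[p])‖ = 1 := by
    rw [← norm_mul, ← norm_one (α := ℂ_[p])]
    exact congrArg (fun z : 𝓞_ℂ_[p] => ‖(z : ℂ_[p])‖) hxy
  refine (mem_padicComplexInt_iff.1 x.2).antisymm ?_
  rw [← hnorm]
  exact mul_le_of_le_one_right (norm_nonneg _) (mem_padicComplexInt_iff.1 y.2)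

theorem exists_isUnit_apply_of_isUnit_det {n R : Type*} [Fintype n] [DecidableEq n] [CommRing R]
    [IsLocalRing R] {M : Matrix n n R} (hM : IsUnit M.det) (i : n) : ∃ j, IsUnit (M i j) := by
  by_contra! hrow
  refine (IsLocalRing.residue_ne_zero_iff_isUnit _).2 hM ?_
  rw [RingHom.map_det]
  exact det_eq_zero_of_row_eq_zero i fun j => (IsLocalRing.residue_eq_zero_iff _).2 (hrow j)

theorem hasGoodReduction_coe {B : SpecialLinearGroup (Fin 2) ℂ_[p]} (hB : ∀ i j, ‖B.1 i j‖ ≤ 1) :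
    HasGoodReduction (B : PSL2 p) := by
  let M : Matrix (Fin 2) (Fin 2) 𝓞_ℂ_[p] :=
    .of fun i j => ⟨B.1 i j, mem_padicComplexInt_iff.2 (hB i j)⟩
  have hMdet : IsUnit M.det := by
    have hdet : M.det = 1 := Subtype.val_injective <|
      (RingHom.map_det (algebraMap 𝓞_ℂ_[p] ℂ_[p]) M).trans B.2
    exact hdet ▸ isUnit_one
  refine ⟨M, fun v hv => ?_, ?_, fun v hv => ?_⟩
  · have hBv : B.1 *ᵥ v ≠ 0 := fun h => hv (eq_zero_of_mulVec_eq_zero (by simp) h)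
    exact ⟨hBv, (coe_smul_mk_eq_iff B hv hBv).2 ⟨1, one_smul _ _⟩⟩
  · obtain ⟨j, hj⟩ := exists_isUnit_apply_of_isUnit_det hMdet 0
    exact ⟨0, j, norm_eq_one_of_isUnit hj⟩
  · refine eq_zero_of_mulVec_eq_zero ?_ hv
    rw [← RingHom.mapMatrix_apply, ← RingHom.map_det]
    exact (hMdet.map (IsLocalRing.residue 𝓞_ℂ_[p])).ne_zero

theorem hasPotentiallyGoodReduction_of_finite (G : Subgroup (PSL2 p)) [Finite G] :
    HasPotentiallyGoodReduction G := by
  obtain ⟨h, hh⟩ := exists_specialLinearGroup_conj_norm_le_one (G.comap (QuotientGroup.mk' _))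
  refine ⟨h, fun g hg => ?_⟩
  obtain ⟨A, rfl⟩ := QuotientGroup.mk_surjective g
  exact hasGoodReduction_coe (hh A hg)

theorem finite_stabilizer_of_limitSet_eq_empty {G : Subgroup (PSL2 p)} (hG : limitSet G = ∅)
    (b : P1 p) : Finite (stabilizer G b) := by
  by_contra hinf
  rw [not_finite_iff_infinite] at hinf
  let g : ℕ ↪ stabilizer G b := Infinite.natEmbedding _
  have hb : b ∈ limitSet G := by
    refine ⟨b, fun n => (g n).1.1, fun n => (g n).1.2, fun m n hmn =>
      g.injective (Subtype.ext (Subtype.ext hmn)), ?_⟩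
    have hfix (n : ℕ) : ((g n).1.1 : PSL2 p) • b = b := (g n).2
    simp only [hfix, chordalDist_self]
    exact tendsto_const_nhds
  rw [hG] at hb
  exact hb

end GoodReduction

end PadicMobius

theorem theorem3 (p : ℕ) [Fact p.Prime] (G : Subgroup (PadicMobius.PSL2 p))
    (hG : PadicMobius.limitSet G = ∅) :
    PadicMobius.HasPotentiallyGoodReduction G := by
  have : Finite G := PadicMobius.finite_of_finite_stabilizer
    (PadicMobius.finite_stabilizer_of_limitSet_eq_empty hG)
  exact PadicMobius.hasPotentiallyGoodReduction_of_finite G
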